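/- Let $(\Omega,\mathcal F,P)$ be a probability space and let $\{S(t):t\ge 0\}$ be a real-valued Lévy process on it (null at time $0$, with independent and stationary increments and a.s. càdlàg paths) such that $\kappa_S(\theta):=\log\mathbb E[e^{\theta S(1)}]\in(-\infty,\infty]$ is finite in a neighbourhood of $\theta=0$. Let $f:[0,\infty)\to\mathbb R$ be convex and non-decreasing with $f(0)=0$ and right derivative $f'(0)=0$, and let $\{L_f(t):t\ge 0\}$ be a nonnegative process, independent of $\{S(t):t\ge 0\}$, such that for every $\rho\in\mathbb R$ $$\lim_{t\to\infty}\frac1t\log\mathbb E\big[e^{\rho L_f(t)}\big]=\Upsilon_f(\rho):=\begin{cases}f(\rho)&\text{if }\rho\ge 0,\\ 0&\text{if }\rho<0.\end{cases}$$ Put $\Upsilon_f(\infty):=\infty$ and $$\Lambda_{f,S}(\theta):=\Upsilon_f(\kappa_S(\theta))\in[0,\infty],\qquad \theta\in\mathbb R .$$ Assume that $\Lambda_{f,S}$ is essentially smooth, that is: with $\mathcal D:=\{\theta\in\mathbb R:\Lambda_{f,S}(\theta)<\infty\}$, the interior of $\mathcal D$ is non-empty, $\Lambda_{f,S}$ is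 differentiable throughout the interior of $\mathcal D$, and $|\Lambda_{f,S}'(\theta_n)|\to\infty$ whenever $(\theta_n)$ is a sequence of points in the interior of $\mathcal D$ that converges to a boundary point of $\mathcal D$. Then $\left\{\frac{S(L_f(t))}{t}:t>0\right\}$ satisfies the large deviation principle with speed $t$ and good rate function $$I(x):=\sup_{\theta\in\mathbb R}\{\theta x-\Lambda_{f,S}(\theta)\},\qquad x\in\mathbb R .$$ That is, $I:\mathbb R\to[0,\infty]$ is lower semicontinuous, its level sets $\{x\in\mathbb R:I(x)\le\beta\}$, $\beta\ge 0$, are compact, and $$\limsup_{t\to\infty}\frac1t\log P\Big(\frac{S(L_f(t))}{t}\in C\Big)\le-\inf_{x\in C}I(x)\ \text{ for every closed }C\subseteq\mathbb R,$$ $$\liminf_{t\to\infty}\frac1t\log P\Big(\frac{S(L_f(t))}{t}\in O\Big)\ge-\inf_{x\in O}I(x)\ \text{ for every open }O\subseteq\mathbb R.$$ -/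

import Mathlib

open MeasureTheory ProbabilityTheory Filter Topology Set
open scoped NNReal ENNReal

/-- The logarithmic moment generating function `θ ↦ log 𝔼[exp (θ X)]` of a real random variable,
with values in `[-∞, ∞]` (the value is `∞` exactly when the expectation is infinite). -/
noncomputable def logMGF {Ω : Type*} [MeasurableSpace Ω] (P : Measure Ω) (X : Ω → ℝ) (θ : ℝ) :
    EReal :=
  ENNReal.log (∫⁻ ω, ENNReal.ofReal (Real.exp (θ * X ω)) ∂P)

/-- Real-valued Lévy processes: null at time `0`, with independent and stationary increments and
almost surely càdlàg paths. -/
structure IsLevyProcess {Ω : Type*} [MeasurableSpace Ω] (P : Measure Ω) (S : ℝ≥0 → Ω → ℝ) :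
    Prop where
  measurable : ∀ t, Measurable (S t)
  zero : ∀ᵐ ω ∂P, S 0 ω = 0
  indep : HasIndepIncrements S P
  stationary : ∀ s h : ℝ≥0, IdentDistrib (fun ω ↦ S (s + h) ω - S s ω) (S h) P P
  cadlag : ∀ᵐ ω ∂P, ∀ t : ℝ≥0, ContinuousWithinAt (fun s ↦ S s ω) (Ici t) t ∧
    ∃ l : ℝ, Tendsto (fun s ↦ S s ω) (𝓝[<] t) (𝓝 l)

/-- The function `κ_S(θ) = log 𝔼[exp (θ S(1))]`. -/
noncomputable def kappa {Ω : Type*} [MeasurableSpace Ω] (P : Measure Ω) (S : ℝ≥0 → Ω → ℝ) (θ : ℝ) :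
    EReal :=
  logMGF P (S 1) θ

/-- A Lévy process is light-tailed if `κ_S` is finite in a neighbourhood of the origin. -/
structure IsLightTailedLevy {Ω : Type*} [MeasurableSpace Ω] (P : Measure Ω) (S : ℝ≥0 → Ω → ℝ) :
    Prop extends IsLevyProcess P S where
  finite_near_zero : ∀ᶠ θ in 𝓝 (0 : ℝ), kappa P S θ ≠ ⊤ ∧ kappa P S θ ≠ ⊥

open Classical in
/-- The function `Υ_f`: it is `f` on `[0, ∞)` and `0` on the negative half line; it is extended
by `Υ_f(∞) = ∞` so that it can be composed with `κ_S`. -/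
noncomputable def Upsilon (f : ℝ → ℝ) (ρ : EReal) : EReal :=
  if ρ = ⊤ then ⊤ else if 0 ≤ ρ then ((f ρ.toReal : ℝ) : EReal) else 0

/-- A nonnegative process `L` whose scaled logarithmic moment generating function converges to
`Υ_f`, where `f` is convex and non-decreasing on `[0, ∞)` with `f(0) = 0` and right derivative
`f'(0) = 0`. -/
structure IsTimeChange {Ω : Type*} [MeasurableSpace Ω] (P : Measure Ω) (f : ℝ → ℝ)
    (L : ℝ≥0 → Ω → ℝ≥0) : Prop where
  measurable : ∀ t, Measurable (L t)
  convex : ConvexOn ℝ (Ici 0) f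
  mono : MonotoneOn f (Ici 0)
  zero : f 0 = 0
  deriv_zero : HasDerivWithinAt f 0 (Ici 0) 0
  tendsto : ∀ ρ : ℝ, Tendsto
    (fun t : ℝ≥0 ↦ (((t : ℝ)⁻¹ : ℝ) : EReal) * logMGF P (fun ω ↦ (L t ω : ℝ)) ρ)
    atTop (𝓝 (Upsilon f (ρ : EReal)))

/-- The function `Λ_{f,S} = Υ_f ∘ κ_S`. -/
noncomputable def LambdaFS {Ω : Type*} [MeasurableSpace Ω] (P : Measure Ω) (f : ℝ → ℝ)
    (S : ℝ≥0 → Ω → ℝ) (θ : ℝ) : EReal :=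
  Upsilon f (kappa P S θ)

/-- The effective domain `{θ : Λ(θ) < ∞}`. -/
def effDomain (Λ : ℝ → EReal) : Set ℝ := {θ | Λ θ < ⊤}

/-- Essential smoothness: the effective domain has non-empty interior, the function is (finite and)
differentiable there, and it is steep. -/
structure EssentiallySmooth (Λ : ℝ → EReal) : Prop where
  nonempty_interior : (interior (effDomain Λ)).Nonempty
  differentiable : ∀ θ ∈ interior (effDomain Λ),
    Λ θ ≠ ⊥ ∧ DifferentiableAt ℝ (fun η ↦ (Λ η).toReal) θ
  steep : ∀ θ : ℕ → ℝ, (∀ n, θ n ∈ interior (effDomain Λ)) →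
    ∀ a ∈ frontier (effDomain Λ), Tendsto θ atTop (𝓝 a) →
      Tendsto (fun n ↦ |deriv (fun η ↦ (Λ η).toReal) (θ n)|) atTop atTop

/-- The Legendre-Fenchel transform `x ↦ sup_θ (θ x - Λ(θ))`. -/
noncomputable def legendre (Λ : ℝ → EReal) (x : ℝ) : EReal :=
  ⨆ θ : ℝ, (((θ * x : ℝ) : EReal) - Λ θ)

/-- Rate functions: lower semicontinuous functions with values in `[0, ∞]`. -/
structure IsRateFunction (I : ℝ → EReal) : Prop where
  nonneg : ∀ x, 0 ≤ I x
  lsc : LowerSemicontinuous I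

/-- A rate function is good if its level sets are compact. -/
structure IsGoodRateFunction (I : ℝ → EReal) : Prop extends IsRateFunction I where
  compact_level : ∀ β : ℝ, 0 ≤ β → IsCompact {x | I x ≤ (β : EReal)}

/-- The family of real random variables `Z t`, `t > 0`, satisfies the large deviation principle
with speed `v` and rate function `I`. -/
structure SatisfiesLDP {Ω : Type*} [MeasurableSpace Ω] (P : Measure Ω) (Z : ℝ≥0 → Ω → ℝ)
    (v : ℝ≥0 → ℝ) (I : ℝ → EReal) : Prop where
  aemeasurable : ∀ t, 0 < t → AEMeasurable (Z t) P
  speed : Tendsto v atTop atTop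
  rate : IsRateFunction I
  upper : ∀ C : Set ℝ, IsClosed C →
    limsup (fun t ↦ (((v t)⁻¹ : ℝ) : EReal) * ENNReal.log (P {ω | Z t ω ∈ C})) atTop
      ≤ -(⨅ x ∈ C, I x)
  lower : ∀ O : Set ℝ, IsOpen O →
    -(⨅ x ∈ O, I x)
      ≤ liminf (fun t ↦ (((v t)⁻¹ : ℝ) : EReal) * ENNReal.log (P {ω | Z t ω ∈ O})) atTop

/-!
The scaled logarithmic moment generating functions of `S(L_f(t))` converge to `Λ_{f,S}`, and the
Gärtner–Ellis argument on the line turns this into the large deviation principle.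

*Moment generating functions.* For a Lévy process, `𝔼[exp (θ S(s))] = exp (s κ_S(θ))` wherever
`κ_S(θ)` is finite (`IsLevyProcess.lintegral_exp_eq`). Almost sure right-continuity of the paths
replaces evaluation at a time by a functional that is jointly measurable in path and time
(`rightEval`), so that Tonelli's theorem applies to the independent pair `(S, L_f(t))` and gives
`𝔼[exp (θ S(L_f(t)))] = 𝔼[exp (κ_S(θ) L_f(t))]` (`logMGF_timeChange`). The convergence assumed of
`L_f` at `ρ = κ_S(θ)` is then the one required at `θ`. Nothing is needed where `κ_S(θ) = ∞`.

*Upper bound.* A closed set not containing `0` lies beyond its points nearest to `0` on either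
side, and the Chernoff bound applies to each half-line (`eventually_measure_closed_le`).

*Lower bound.* At a slope `y = Λ'(η)` the moment `𝔼[exp (η S(L_f(t)))]` is carried by the event that
`S(L_f(t)) / t` is close to `y`, by Chernoff bounds at exponents near `η`; this bounds the
probability of that event from below by `exp (-t (η y - Λ(η)))` up to subexponential corrections
(`eventually_le_measure_of_hasDerivAt`). By the intermediate value property of derivatives and
steepness, every `x` with `I(x) < ∞` is approximated by slopes `y` with `η y - Λ(η) ≤ I(x)`
(`exists_deriv_mem_of_legendre_lt_top`). Convexity of `Λ` is not used: it is enough that `Λ` is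
nonnegative, vanishes at `0` and does not increase when `θ` is contracted towards `0`.
-/

/-! ### The logarithmic scale -/

lemma inv_mul_log_le_iff {t : ℝ} (ht : 0 < t) {u : ℝ≥0∞} {c : ℝ} :
    ((t⁻¹ : ℝ) : EReal) * ENNReal.log u ≤ (c : EReal) ↔ u ≤ ENNReal.ofReal (Real.exp (t * c)) := by
  have hti : 0 < t⁻¹ := inv_pos.2 ht
  obtain ⟨w, rfl⟩ : ∃ w, u = EReal.exp w := ⟨ENNReal.log u, (ENNReal.exp_log u).symm⟩
  rw [EReal.log_exp, ← EReal.exp_coe, EReal.exp_le_exp_iff]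
  induction w with
  | bot => simp [EReal.coe_mul_bot_of_pos hti, -EReal.coe_mul]
  | top => simp [EReal.coe_mul_top_of_pos hti, -EReal.coe_mul]
  | coe w => rw [← EReal.coe_mul, EReal.coe_le_coe_iff, EReal.coe_le_coe_iff, inv_mul_le_iff₀ ht]

lemma le_inv_mul_log_iff {t : ℝ} (ht : 0 < t) {u : ℝ≥0∞} {c : ℝ} :
    (c : EReal) ≤ ((t⁻¹ : ℝ) : EReal) * ENNReal.log u ↔ ENNReal.ofReal (Real.exp (t * c)) ≤ u := by
  have hti : 0 < t⁻¹ := inv_pos.2 ht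
  obtain ⟨w, rfl⟩ : ∃ w, u = EReal.exp w := ⟨ENNReal.log u, (ENNReal.exp_log u).symm⟩
  rw [EReal.log_exp, ← EReal.exp_coe, EReal.exp_le_exp_iff]
  induction w with
  | bot => simp [EReal.coe_mul_bot_of_pos hti, -EReal.coe_mul]
  | top => simp [EReal.coe_mul_top_of_pos hti, -EReal.coe_mul]
  | coe w => rw [← EReal.coe_mul, EReal.coe_le_coe_iff, EReal.coe_le_coe_iff, le_inv_mul_iff₀ ht]

/-! ### Slopes of a steep function -/

/-- A finite upper bound for `θ * x - Λ θ` forces `x` to be a limit from below of slopes of `Λ`.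
A point where the slope passes `x` yields `x` itself as a slope (Darboux); if there is none, then
steepness forces `D` to be unbounded above, and slopes staying below `x - ε` would make
`θ * x - Λ θ` grow at least like `ε * θ`. -/
lemma exists_deriv_mem_Ioc_of_bddAbove {D : Set ℝ} {Λ : ℝ → ℝ} (h0 : 0 ∈ interior D)
    (hD : Convex ℝ D) (hΛ0 : Λ 0 = 0) (hnn : ∀ θ, 0 ≤ Λ θ)
    (hmono : MonotoneOn Λ (D ∩ Ici 0)) (hdiff : ∀ θ ∈ interior D, DifferentiableAt ℝ Λ θ)
    (hsteep : ∀ θ : ℕ → ℝ, (∀ n, θ n ∈ interior D) → ∀ a ∈ frontier D, Tendsto θ atTop (𝓝 a) →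
      Tendsto (fun n ↦ |deriv Λ (θ n)|) atTop atTop)
    {x M ε : ℝ} (hx : 0 ≤ x) (hM : ∀ θ ∈ D, θ * x - Λ θ ≤ M) (hε : 0 < ε) :
    ∃ η ∈ interior D, 0 ≤ η ∧ deriv Λ η ∈ Ioc (x - ε) x := by
  by_contra! hcon
  have hd0 : deriv Λ 0 = 0 :=
    IsLocalMin.deriv_eq_zero (Eventually.of_forall fun θ ↦ by rw [hΛ0]; exact hnn θ)
  have hle : ∀ η ∈ interior D, 0 ≤ η → deriv Λ η ≤ x - ε := by
    intro η hη hη0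
    by_contra! hlt
    have hxη : x < deriv Λ η := by
      by_contra! h
      exact hcon η hη hη0 ⟨hlt, h⟩
    have hoc : OrdConnected (deriv Λ '' (interior D ∩ Ici 0)) :=
      ((hD.interior.ordConnected).inter ordConnected_Ici).image_deriv fun θ hθ ↦ hdiff θ hθ.1
    obtain ⟨c, ⟨hc, hc0⟩, hcx⟩ := hoc.out ⟨0, ⟨h0, self_mem_Ici⟩, rfl⟩ ⟨η, ⟨hη, hη0⟩, rfl⟩
      ⟨by rw [hd0]; exact hx, hxη.le⟩
    exact hcon c hc hc0 ⟨by linarith, hcx.le⟩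
  have hge : ∀ η ∈ interior D, 0 < η → 0 ≤ deriv Λ η := by
    intro η hη hη0
    have hopen : IsOpen (interior D ∩ Ioi 0) := isOpen_interior.inter isOpen_Ioi
    rw [← derivWithin_of_isOpen hopen ⟨hη, hη0⟩]
    exact (hmono.mono fun θ hθ ↦
      ⟨interior_subset hθ.1, Ioi_subset_Ici_self hθ.2⟩).derivWithin_nonneg
  have hDne : D.Nonempty := ⟨0, interior_subset h0⟩
  by_cases hb : BddAbove D
  · set b := sSup D with hbdef
    have hbcl : b ∈ closure D := csSup_mem_closure hDne hb
    have hb_not : b ∉ interior D := by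
      intro h
      have : interior D ⊆ interior (Iic b) := interior_mono fun θ hθ ↦ le_csSup hb hθ
      rw [interior_Iic] at this
      exact lt_irrefl b (this h)
    have hb0 : 0 < b := by
      refine lt_of_le_of_ne (le_csSup hb (interior_subset h0)) ?_
      intro h
      exact hb_not (h ▸ h0)
    have hlim : Tendsto (fun n : ℕ ↦ b - b / ((n : ℝ) + 2)) atTop (𝓝 b) := by
      have h1 : Tendsto (fun n : ℕ ↦ b / ((n : ℝ) + 2)) atTop (𝓝 0) :=
        tendsto_const_nhds.div_atTop
          (tendsto_atTop_add_const_right _ _ tendsto_natCast_atTop_atTop)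
      simpa using tendsto_const_nhds.sub h1
    have hpos : ∀ n : ℕ, 0 < b - b / ((n : ℝ) + 2) := by
      intro n
      have : b / ((n : ℝ) + 2) < b := div_lt_self hb0 (by linarith [n.cast_nonneg (α := ℝ)])
      linarith
    have hmem : ∀ n : ℕ, b - b / ((n : ℝ) + 2) ∈ interior D := by
      intro n
      have hlt : b - b / ((n : ℝ) + 2) < b := by
        have : 0 < b / ((n : ℝ) + 2) := by positivity
        linarith
      obtain ⟨d, hdD, hd⟩ := exists_lt_of_lt_csSup hDne hlt
      have hsub : Ioo 0 d ⊆ interior D :=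
        interior_maximal (fun θ hθ ↦
          hD.ordConnected.out (interior_subset h0) hdD ⟨hθ.1.le, hθ.2.le⟩) isOpen_Ioo
      exact hsub ⟨hpos n, hd⟩
    have hT := hsteep _ hmem b ⟨hbcl, hb_not⟩ hlim
    obtain ⟨n, hn⟩ := (hT.eventually_gt_atTop (x - ε)).exists
    rw [abs_of_nonneg (hge _ (hmem n) (hpos n))] at hn
    exact absurd (hle _ (hmem n) (hpos n).le) (not_le.2 hn)
  · have hIci : ∀ θ : ℝ, 0 ≤ θ → θ ∈ interior D := by
      intro θ hθ
      rcases hθ.eq_or_lt with rfl | hθ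
      · exact h0
      obtain ⟨d, hdD, hd⟩ := not_bddAbove_iff.1 hb θ
      exact interior_maximal (fun u (hu : u ∈ Ioo 0 d) ↦
          hD.ordConnected.out (interior_subset h0) hdD ⟨hu.1.le, hu.2.le⟩) isOpen_Ioo ⟨hθ, hd⟩
    set θ := (|M| + 1) / ε with hθdef
    have hθ : 0 ≤ θ := by positivity
    have hmv := (convex_Ici (0 : ℝ)).image_sub_le_mul_sub_of_deriv_le (f := Λ) (C := x - ε)
      (fun u hu ↦ (hdiff u (hIci u hu)).continuousAt.continuousWithinAt)
      (fun u hu ↦ (hdiff u (hIci u (interior_subset hu))).differentiableWithinAt)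
      (fun u hu ↦ hle u (hIci u (interior_subset hu)) (interior_subset hu)) 0 self_mem_Ici θ hθ hθ
    have h1 := hM θ (interior_subset (hIci θ hθ))
    have h2 : ε * θ = |M| + 1 := by rw [hθdef]; field_simp
    rw [hΛ0] at hmv
    nlinarith [le_abs_self M]

/-! ### Exponential estimates -/

section Estimates

variable {Ω : Type*} [MeasurableSpace Ω] {P : Measure Ω} {X : ℝ≥0 → Ω → ℝ} {θ l : ℝ}

lemma eventually_lintegral_exp_le
    (h : Tendsto (fun t : ℝ≥0 ↦ (((t : ℝ)⁻¹ : ℝ) : EReal) * logMGF P (X t) θ) atTop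
      (𝓝 (l : EReal)))
    {c : ℝ} (hc : l < c) :
    ∀ᶠ t : ℝ≥0 in atTop, ∫⁻ ω, ENNReal.ofReal (Real.exp (θ * X t ω)) ∂P
      ≤ ENNReal.ofReal (Real.exp (t * c)) := by
  filter_upwards [h.eventually_lt_const (EReal.coe_lt_coe_iff.2 hc), eventually_gt_atTop 0]
    with t ht ht0
  exact (inv_mul_log_le_iff (NNReal.coe_pos.2 ht0)).1 ht.le

lemma eventually_le_lintegral_exp
    (h : Tendsto (fun t : ℝ≥0 ↦ (((t : ℝ)⁻¹ : ℝ) : EReal) * logMGF P (X t) θ) atTop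
      (𝓝 (l : EReal)))
    {c : ℝ} (hc : c < l) :
    ∀ᶠ t : ℝ≥0 in atTop, ENNReal.ofReal (Real.exp (t * c))
      ≤ ∫⁻ ω, ENNReal.ofReal (Real.exp (θ * X t ω)) ∂P := by
  filter_upwards [h.eventually_const_lt (EReal.coe_lt_coe_iff.2 hc), eventually_gt_atTop 0]
    with t ht ht0
  exact (le_inv_mul_log_iff (NNReal.coe_pos.2 ht0)).1 ht.le

/-- The Chernoff bound, for the part of an exponential moment carried by a half-line; `η = 0` is
the bound for probabilities. The sign of `θ` decides which half-line is meant. -/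
lemma eventually_setLIntegral_exp_le {η d r : ℝ}
    (h : Tendsto (fun t : ℝ≥0 ↦ (((t : ℝ)⁻¹ : ℝ) : EReal) * logMGF P (X t) (η + θ)) atTop
      (𝓝 (l : EReal)))
    (hX : ∀ t, 0 < t → AEMeasurable (X t) P) (hr : l - θ * d < r) :
    ∀ᶠ t : ℝ≥0 in atTop,
      ∫⁻ ω in {ω | θ * d ≤ θ * (X t ω / t)}, ENNReal.ofReal (Real.exp (η * X t ω)) ∂P
        ≤ ENNReal.ofReal (Real.exp (t * r)) := by
  filter_upwards [eventually_lintegral_exp_le h (c := r + θ * d) (by linarith),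
    eventually_gt_atTop 0] with t ht ht0
  have ht0' : (0 : ℝ) < t := NNReal.coe_pos.2 ht0
  have hXt := hX t ht0
  have hms : NullMeasurableSet {ω | θ * d ≤ θ * (X t ω / t)} P :=
    nullMeasurableSet_le aemeasurable_const ((hXt.div_const _).const_mul _)
  calc
    _ ≤ ∫⁻ ω in {ω | θ * d ≤ θ * (X t ω / t)},
        ENNReal.ofReal (Real.exp (-(t * (θ * d)))) *
          ENNReal.ofReal (Real.exp ((η + θ) * X t ω)) ∂P := by
      refine lintegral_mono_ae ?_
      filter_upwards [ae_restrict_mem₀ hms] with ω hω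
      rw [← ENNReal.ofReal_mul (Real.exp_nonneg _), ← Real.exp_add]
      refine ENNReal.ofReal_le_ofReal (Real.exp_le_exp.2 ?_)
      have h1 : θ * d ≤ θ * (X t ω / t) := hω
      have h2 : (t : ℝ) * (θ * (X t ω / t)) = θ * X t ω := by field_simp
      nlinarith
    _ = ENNReal.ofReal (Real.exp (-(t * (θ * d)))) *
        ∫⁻ ω in {ω | θ * d ≤ θ * (X t ω / t)}, ENNReal.ofReal (Real.exp ((η + θ) * X t ω)) ∂P :=
      lintegral_const_mul' _ _ ENNReal.ofReal_ne_top
    _ ≤ ENNReal.ofReal (Real.exp (-(t * (θ * d)))) *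
        ENNReal.ofReal (Real.exp (t * (r + θ * d))) := by
      gcongr
      exact (setLIntegral_le_lintegral _ _).trans ht
    _ = _ := by
      rw [← ENNReal.ofReal_mul (Real.exp_nonneg _), ← Real.exp_add]
      congr 2
      ring

lemma eventually_measure_le {d r : ℝ}
    (h : Tendsto (fun t : ℝ≥0 ↦ (((t : ℝ)⁻¹ : ℝ) : EReal) * logMGF P (X t) θ) atTop
      (𝓝 (l : EReal)))
    (hX : ∀ t, 0 < t → AEMeasurable (X t) P) (hr : r < θ * d - l) :
    ∀ᶠ t : ℝ≥0 in atTop,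
      P {ω | θ * d ≤ θ * (X t ω / t)} ≤ ENNReal.ofReal (Real.exp (t * -r)) := by
  have := eventually_setLIntegral_exp_le (η := 0) (r := -r) (d := d) (by simpa using h) hX
    (by linarith)
  simpa using this

end Estimates

/-! ### The local lower bound -/

section LowerBound

variable {Ω : Type*} [MeasurableSpace Ω] {P : Measure Ω} {X : ℝ≥0 → Ω → ℝ}

/-- The local lower bound at a slope `y = Λ'(η)`. By the Chernoff bound at `η ± u`, the part of
`𝔼[exp (η X)]` away from `X t / t ≈ y` has exponential rate strictly below `Λ η`, because
`Λ (η ± u) ∓ u y < Λ η + u δ` for small `u`; so almost all of this moment comes from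
`X t / t ≈ y`, where the integrand is about `exp (t η y)`. -/
lemma eventually_le_measure_of_hasDerivAt [IsFiniteMeasure P] {Λ : ℝ → ℝ} {η y c : ℝ} {O : Set ℝ}
    (h : ∀ᶠ θ in 𝓝 η, Tendsto (fun t : ℝ≥0 ↦ (((t : ℝ)⁻¹ : ℝ) : EReal) * logMGF P (X t) θ) atTop
      (𝓝 (Λ θ : EReal)))
    (hX : ∀ t, 0 < t → AEMeasurable (X t) P) (hd : HasDerivAt Λ y η) (hO : IsOpen O) (hy : y ∈ O)
    (hc : c < Λ η - η * y) :
    ∀ᶠ t : ℝ≥0 in atTop, ENNReal.ofReal (Real.exp (t * c)) ≤ P {ω | X t ω / t ∈ O} := by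
  obtain ⟨δ₀, hδ₀, hball⟩ := Metric.isOpen_iff.1 hO y hy
  set g := Λ η - η * y - c with hgdef
  have hg : 0 < g := by linarith
  obtain ⟨δ, hδ, hδδ₀, hηδ⟩ : ∃ δ, 0 < δ ∧ δ ≤ δ₀ ∧ |η| * δ ≤ g / 4 := by
    refine ⟨min δ₀ (g / (4 * (|η| + 1))), by positivity, min_le_left _ _, ?_⟩
    calc |η| * min δ₀ (g / (4 * (|η| + 1))) ≤ (|η| + 1) * (g / (4 * (|η| + 1))) := by
          gcongr
          · linarith
          · exact min_le_right _ _
      _ = g / 4 := by field_simp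
  obtain ⟨u, hu, hup, hum, hlp, hlm⟩ : ∃ u : ℝ, 0 < u ∧
      Tendsto (fun t : ℝ≥0 ↦ (((t : ℝ)⁻¹ : ℝ) : EReal) * logMGF P (X t) (η + u)) atTop
        (𝓝 (Λ (η + u) : EReal)) ∧
      Tendsto (fun t : ℝ≥0 ↦ (((t : ℝ)⁻¹ : ℝ) : EReal) * logMGF P (X t) (η + -u)) atTop
        (𝓝 (Λ (η + -u) : EReal)) ∧
      Λ (η + u) - Λ η - u * y ≤ δ / 2 * u ∧ Λ (η + -u) - Λ η + u * y ≤ δ / 2 * u := by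
    have hlo := (hasDerivAt_iff_isLittleO_nhds_zero.1 hd).bound (half_pos hδ)
    have h0 : ∀ᶠ u in 𝓝 (0 : ℝ), Tendsto (fun t : ℝ≥0 ↦
        (((t : ℝ)⁻¹ : ℝ) : EReal) * logMGF P (X t) (η + u)) atTop (𝓝 (Λ (η + u) : EReal)) := by
      have : Tendsto (fun u : ℝ ↦ η + u) (𝓝 0) (𝓝 η) := by
        simpa using ((continuous_const_add η).tendsto 0)
      exact this.eventually h
    have hneg : Tendsto (fun u : ℝ ↦ -u) (𝓝 0) (𝓝 0) := by
      simpa using (continuous_neg (G := ℝ)).tendsto 0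
    have hall := (h0.and hlo).and (hneg.eventually (h0.and hlo))
    obtain ⟨u, ⟨⟨h1, h2⟩, h3, h4⟩, hu⟩ :=
      ((hall.filter_mono nhdsWithin_le_nhds).and (self_mem_nhdsWithin (s := Ioi (0 : ℝ)))).exists
    have hu : 0 < u := hu
    simp only [smul_eq_mul, Real.norm_eq_abs, abs_neg, abs_of_pos hu] at h2 h4
    exact ⟨u, hu, h1, h3, (le_abs_self _).trans h2, by linarith [(le_abs_self _).trans h4]⟩
  obtain ⟨ρ, hρ, hρ1, hρ2⟩ : ∃ ρ, 0 < ρ ∧ ρ ≤ u * δ / 8 ∧ ρ ≤ g / 4 :=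
    ⟨min (u * δ / 8) (g / 4), by positivity, min_le_left _ _, min_le_right _ _⟩
  have hup' := eventually_setLIntegral_exp_le (d := y + δ) (r := Λ η - 2 * ρ) hup hX (by nlinarith)
  have hum' := eventually_setLIntegral_exp_le (d := y - δ) (r := Λ η - 2 * ρ) hum hX (by nlinarith)
  have hmid := eventually_le_lintegral_exp h.self_of_nhds (c := Λ η - ρ) (by linarith)
  have hexp : ∀ a : ℝ, 0 < a → ∀ᶠ t : ℝ≥0 in atTop, 4 ≤ Real.exp (t * a) := fun a ha ↦
    (Real.tendsto_exp_atTop.comp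
      (NNReal.tendsto_coe_atTop.2 tendsto_id |>.atTop_mul_const ha)).eventually_ge_atTop 4
  filter_upwards [hup', hum', hmid, hexp ρ hρ, hexp (g / 2) (by positivity),
    eventually_gt_atTop 0] with t h1 h2 h3 h4 h5 ht0
  have ht0' : (0 : ℝ) < t := NNReal.coe_pos.2 ht0
  set A := {ω | |X t ω / t - y| < δ} with hA
  have hAmeas : NullMeasurableSet A P :=
    nullMeasurableSet_lt (((hX t ht0).div_const _).sub_const _).abs aemeasurable_const
  have hAO : A ⊆ {ω | X t ω / t ∈ O} := fun ω hω ↦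
    hball (Metric.ball_subset_ball hδδ₀ (by simpa [Real.dist_eq, hA] using hω))
  refine le_trans ?_ (measure_mono hAO)
  have hAint : ∫⁻ ω in A, ENNReal.ofReal (Real.exp (η * X t ω)) ∂P
      ≤ ENNReal.ofReal (Real.exp (t * (η * y + g / 4))) * P A := by
    rw [← setLIntegral_const]
    refine lintegral_mono_ae ?_
    filter_upwards [ae_restrict_mem₀ hAmeas] with ω hω
    refine ENNReal.ofReal_le_ofReal (Real.exp_le_exp.2 ?_)
    have e1 : η * X t ω = t * (η * y + η * (X t ω / t - y)) := by field_simp; ring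
    have e2 : η * (X t ω / t - y) ≤ |η| * δ :=
      (le_abs_self _).trans (by rw [abs_mul]; gcongr; exact le_of_lt hω)
    rw [e1]
    gcongr
    linarith
  have hcover : (univ : Set Ω) ⊆ A ∪ ({ω | u * (y + δ) ≤ u * (X t ω / t)} ∪
      {ω | -u * (y - δ) ≤ -u * (X t ω / t)}) := by
    intro ω _
    by_cases hω : |X t ω / t - y| < δ
    · exact Or.inl hω
    · right
      rcases le_abs'.1 (not_lt.1 hω) with h | h
      · right
        show -u * (y - δ) ≤ -u * (X t ω / t)
        nlinarith
      · left
        show u * (y + δ) ≤ u * (X t ω / t)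
        nlinarith
  have hsum : ENNReal.ofReal (Real.exp (t * (Λ η - ρ)))
      ≤ ENNReal.ofReal (Real.exp (t * (η * y + g / 4))) * P A +
        (ENNReal.ofReal (Real.exp (t * (Λ η - 2 * ρ))) +
          ENNReal.ofReal (Real.exp (t * (Λ η - 2 * ρ)))) := by
    refine h3.trans ?_
    rw [← setLIntegral_univ]
    refine (lintegral_mono_set hcover).trans ((lintegral_union_le _ _ _).trans ?_)
    exact add_le_add hAint ((lintegral_union_le _ _ _).trans (add_le_add h1 h2))
  rw [← ENNReal.ofReal_toReal (measure_ne_top P A), ← ENNReal.ofReal_mul (Real.exp_nonneg _),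
    ← ENNReal.ofReal_add (Real.exp_nonneg _) (Real.exp_nonneg _),
    ← ENNReal.ofReal_add (by positivity) (by positivity),
    ENNReal.ofReal_le_ofReal_iff (by positivity)] at hsum
  rw [← ENNReal.ofReal_toReal (measure_ne_top P A)]
  refine ENNReal.ofReal_le_ofReal ?_
  set p := (P A).toReal
  have hp : 0 ≤ p := ENNReal.toReal_nonneg
  -- The error terms are at most half of the left-hand side, since `4 ≤ exp (t * ρ)`.
  have e1 : Real.exp (t * (Λ η - ρ)) = Real.exp (t * ρ) * Real.exp (t * (Λ η - 2 * ρ)) := by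
    rw [← Real.exp_add]; ring_nf
  have e2 : Real.exp (t * (Λ η - ρ)) ≤ 2 * (Real.exp (t * (η * y + g / 4)) * p) := by
    have := Real.exp_pos (t * (Λ η - 2 * ρ))
    nlinarith
  have e3 : Real.exp (t * (g / 2)) * (Real.exp (t * c) * Real.exp (t * (η * y + g / 4)))
      ≤ Real.exp (t * (Λ η - ρ)) := by
    rw [← Real.exp_add, ← Real.exp_add]
    refine Real.exp_le_exp.2 ?_
    have : g / 2 + (c + (η * y + g / 4)) ≤ Λ η - ρ := by linarith
    nlinarith
  have e4 : 4 * (Real.exp (t * c) * Real.exp (t * (η * y + g / 4)))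
      ≤ 2 * (Real.exp (t * (η * y + g / 4)) * p) :=
    (mul_le_mul_of_nonneg_right h5 (by positivity)).trans (e3.trans e2)
  have e5 := Real.exp_pos (t * (η * y + g / 4))
  have e6 := Real.exp_pos (t * c)
  have e7 : 2 * Real.exp (t * c) ≤ p := by
    refine le_of_mul_le_mul_left ?_ e5
    linarith
  linarith

end LowerBound

/-! ### The Legendre transform -/

section Legendre

variable {Λ : ℝ → EReal}

lemma coe_toReal_of_mem_effDomain (hnn : ∀ θ, 0 ≤ Λ θ) {θ : ℝ} (hθ : θ ∈ effDomain Λ) :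
    ((Λ θ).toReal : EReal) = Λ θ :=
  EReal.coe_toReal (ne_of_lt hθ) (ne_bot_of_le_ne_bot (by simp) (hnn θ))

lemma coe_sub_le_legendre (hnn : ∀ θ, 0 ≤ Λ θ) {θ : ℝ} (hθ : θ ∈ effDomain Λ) (x : ℝ) :
    ((θ * x - (Λ θ).toReal : ℝ) : EReal) ≤ legendre Λ x := by
  rw [EReal.coe_sub, coe_toReal_of_mem_effDomain hnn hθ]
  exact le_iSup (fun θ : ℝ ↦ ((θ * x : ℝ) : EReal) - Λ θ) θ

lemma exists_lt_of_coe_lt_legendre (hnn : ∀ θ, 0 ≤ Λ θ) {x r : ℝ}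
    (h : (r : EReal) < legendre Λ x) :
    ∃ θ ∈ effDomain Λ, r < θ * x - (Λ θ).toReal := by
  obtain ⟨θ, hθ⟩ := lt_iSup_iff.1 h
  have hD : θ ∈ effDomain Λ := by
    by_contra hD
    have : Λ θ = ⊤ := not_lt_top_iff.1 hD
    rw [this, EReal.sub_top] at hθ
    exact not_lt_bot hθ
  refine ⟨θ, hD, ?_⟩
  rw [← coe_toReal_of_mem_effDomain hnn hD, ← EReal.coe_sub, EReal.coe_lt_coe_iff] at hθ
  exact hθ

lemma legendre_nonneg (hΛ0 : Λ 0 = 0) (x : ℝ) : 0 ≤ legendre Λ x := by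
  refine le_trans ?_ (le_iSup (fun θ : ℝ ↦ ((θ * x : ℝ) : EReal) - Λ θ) 0)
  simp [hΛ0]

lemma lowerSemicontinuous_legendre (hnn : ∀ θ, 0 ≤ Λ θ) : LowerSemicontinuous (legendre Λ) := by
  refine lowerSemicontinuous_iSup fun θ ↦ Continuous.lowerSemicontinuous ?_
  by_cases hD : θ ∈ effDomain Λ
  · rw [← coe_toReal_of_mem_effDomain hnn hD]
    simp_rw [← EReal.coe_sub]
    exact continuous_coe_real_ereal.comp (by fun_prop)
  · have : Λ θ = ⊤ := not_lt_top_iff.1 hD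
    simp only [this, EReal.sub_top]
    exact continuous_const

lemma isGoodRateFunction_legendre (hΛ0 : Λ 0 = 0) (hnn : ∀ θ, 0 ≤ Λ θ)
    (h0 : 0 ∈ interior (effDomain Λ)) : IsGoodRateFunction (legendre Λ) where
  nonneg := legendre_nonneg hΛ0
  lsc := lowerSemicontinuous_legendre hnn
  compact_level β _ := by
    have hclosed : IsClosed {x | legendre Λ x ≤ (β : EReal)} :=
      (lowerSemicontinuous_legendre hnn).isClosed_preimage β
    obtain ⟨e, he, hball⟩ := Metric.isOpen_iff.1 isOpen_interior 0 h0
    have hp : e / 2 ∈ effDomain Λ :=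
      interior_subset (hball (by simp [abs_of_pos he]; linarith))
    have hm : -(e / 2) ∈ effDomain Λ :=
      interior_subset (hball (by simp [abs_of_pos he]; linarith))
    refine (isCompact_Icc (a := -((β + (Λ (-(e / 2))).toReal) / (e / 2)))
      (b := (β + (Λ (e / 2)).toReal) / (e / 2))).of_isClosed_subset hclosed fun x hx ↦ ?_
    have h1 := EReal.coe_le_coe_iff.1 ((coe_sub_le_legendre hnn hp x).trans hx)
    have h2 := EReal.coe_le_coe_iff.1 ((coe_sub_le_legendre hnn hm x).trans hx)
    constructor
    · rw [neg_le, le_div_iff₀ (by positivity)]; linarith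
    · rw [le_div_iff₀ (by positivity)]; linarith

/-- Points of finite rate are approximated by slopes `Λ'(η)`, at no larger rate
`η Λ'(η) - Λ(η)`. This is where essential smoothness enters. -/
lemma exists_deriv_mem_of_legendre_lt_top (hsm : EssentiallySmooth Λ) (hΛ0 : Λ 0 = 0)
    (hnn : ∀ θ, 0 ≤ Λ θ) (h0 : 0 ∈ interior (effDomain Λ)) (hconv : Convex ℝ (effDomain Λ))
    (hmono : ∀ θ, ∀ s ∈ Icc (0 : ℝ) 1, Λ (s * θ) ≤ Λ θ) {O : Set ℝ} (hO : IsOpen O) {x M : ℝ}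
    (hx : x ∈ O) (hM : legendre Λ x ≤ (M : EReal)) :
    ∃ η ∈ interior (effDomain Λ), deriv (fun θ ↦ (Λ θ).toReal) η ∈ O ∧
      η * deriv (fun θ ↦ (Λ θ).toReal) η - (Λ η).toReal ≤ M := by
  obtain ⟨ε, hε, hball⟩ := Metric.isOpen_iff.1 hO x hx
  set l : ℝ → ℝ := fun θ ↦ (Λ θ).toReal with hl
  set D := effDomain Λ with hDdef
  have hl0 : l 0 = 0 := by simp [hl, hΛ0]
  have hlnn : ∀ θ, 0 ≤ l θ := fun θ ↦ EReal.toReal_nonneg (hnn θ)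
  have hMD : ∀ θ ∈ D, θ * x - l θ ≤ M := fun θ hθ ↦
    EReal.coe_le_coe_iff.1 ((coe_sub_le_legendre hnn hθ x).trans hM)
  have hlmono : ∀ θ ∈ D, ∀ s ∈ Icc (0 : ℝ) 1, l (s * θ) ≤ l θ := fun θ hθ s hs ↦
    EReal.toReal_le_toReal (hmono θ s hs) (ne_bot_of_le_ne_bot (by simp) (hnn _)) (ne_of_lt hθ)
  have hIcc : ∀ a b : ℝ, 0 ≤ a → a ≤ b → ∃ s ∈ Icc (0 : ℝ) 1, a = s * b := by
    intro a b ha hab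
    rcases (ha.trans hab).eq_or_lt with hb | hb
    · exact ⟨1, by simp, by linarith⟩
    · exact ⟨a / b, ⟨by positivity, (div_le_one hb).2 hab⟩, by field_simp⟩
  rcases le_total 0 x with hx0 | hx0
  · obtain ⟨η, hη, hη0, hd1, hd2⟩ := exists_deriv_mem_Ioc_of_bddAbove (D := D) (Λ := l) h0 hconv
      hl0 hlnn (fun a ha b hb hab ↦ by
        obtain ⟨s, hs, rfl⟩ := hIcc a b ha.2 hab
        exact hlmono b hb.1 s hs) (fun θ hθ ↦ (hsm.differentiable θ hθ).2) hsm.steep hx0 hMD hε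
    refine ⟨η, hη, hball ?_, ?_⟩
    · rw [Metric.mem_ball, Real.dist_eq, abs_lt]
      constructor <;> linarith
    · have := hMD η (interior_subset hη)
      nlinarith
  · -- Reflection `θ ↦ -θ` reduces negative `x` to positive `x`.
    have hint : interior (-D) = -interior D := ((Homeomorph.neg ℝ).preimage_interior D).symm
    have hfr : frontier (-D) = -frontier D := (Homeomorph.neg ℝ).preimage_frontier D |>.symm
    have hder : ∀ θ, deriv (fun θ ↦ l (-θ)) θ = -deriv l (-θ) := fun θ ↦ deriv_comp_neg l θ
    obtain ⟨η, hη, hη0, hd1, hd2⟩ := exists_deriv_mem_Ioc_of_bddAbove (D := -D)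
      (Λ := fun θ ↦ l (-θ)) (x := -x) (M := M) (ε := ε) (by rw [hint]; simpa using h0) hconv.neg
      (by simpa using hl0) (fun θ ↦ hlnn _) (fun a ha b hb hab ↦ by
        obtain ⟨s, hs, rfl⟩ := hIcc a b ha.2 hab
        simpa using hlmono (-b) hb.1 s hs)
      (fun θ hθ ↦ by
        rw [hint] at hθ
        exact (hsm.differentiable (-θ) hθ).2.comp θ differentiableAt_id.neg)
      (fun θ hθ a ha hlim ↦ by
        rw [hint] at hθ
        rw [hfr] at ha
        simpa [hder] using hsm.steep (fun n ↦ -θ n) hθ (-a) ha hlim.neg)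
      (by linarith) (fun θ hθ ↦ by simpa using hMD (-θ) hθ) hε
    rw [hder] at hd1 hd2
    rw [hint] at hη
    refine ⟨-η, hη, hball ?_, ?_⟩
    · rw [Metric.mem_ball, Real.dist_eq, abs_lt]
      constructor <;> linarith
    · have := hMD (-η) (interior_subset hη)
      have : (-η) * deriv l (-η) ≤ (-η) * x := by nlinarith
      simp only [hl] at *
      linarith

end Legendre

/-! ### The large deviation principle -/

section GartnerEllis

variable {Ω : Type*} [MeasurableSpace Ω] {P : Measure Ω} {X : ℝ≥0 → Ω → ℝ} {Λ : ℝ → EReal}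

/-- The Chernoff bound for the part of a closed set on the side of the origin selected by
`σ = ±1`: it lies beyond its point nearest to the origin. -/
lemma eventually_measure_closed_le (hX : ∀ t, 0 < t → AEMeasurable (X t) P)
    (hnn : ∀ θ, 0 ≤ Λ θ)
    (hlim : ∀ θ ∈ effDomain Λ, Tendsto (fun t : ℝ≥0 ↦ (((t : ℝ)⁻¹ : ℝ) : EReal) * logMGF P (X t) θ)
      atTop (𝓝 (Λ θ)))
    {C : Set ℝ} (hC : IsClosed C) {r : ℝ} (hr0 : 0 ≤ r)
    (hr : ∀ x ∈ C, (r : EReal) < legendre Λ x) {σ : ℝ} (hσ : σ ^ 2 = 1) :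
    ∀ᶠ t : ℝ≥0 in atTop,
      P {ω | X t ω / t ∈ C ∧ 0 ≤ σ * (X t ω / t)} ≤ ENNReal.ofReal (Real.exp (t * -r)) := by
  set E := {z : ℝ | 0 ≤ z ∧ σ * z ∈ C} with hE
  have hσz : ∀ z, σ * (σ * z) = z := fun z ↦ by rw [← mul_assoc, ← sq, hσ, one_mul]
  rcases E.eq_empty_or_nonempty with hemp | hne
  · refine Eventually.of_forall fun t ↦ ?_
    have : {ω | X t ω / t ∈ C ∧ 0 ≤ σ * (X t ω / t)} = ∅ := by
      ext ω
      simp only [mem_ofPred_eq, mem_empty_iff_false, iff_false, not_and]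
      intro h1 h2
      have : σ * (X t ω / t) ∈ E := ⟨h2, by rwa [hσz]⟩
      rw [hemp] at this
      exact this
    simp [this]
  · have hEcl : IsClosed E :=
      isClosed_Ici.inter (hC.preimage (continuous_const.mul continuous_id))
    have hbdd : BddBelow E := ⟨0, fun z hz ↦ hz.1⟩
    have hd := hEcl.csInf_mem hne hbdd
    set d := sInf E
    obtain ⟨θ, hθ, hθr⟩ := exists_lt_of_coe_lt_legendre hnn (hr _ hd.2)
    have hθd : 0 ≤ θ * σ := by
      -- Otherwise `θ * (σ * d) - Λ θ ≤ 0`.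
      by_contra! hneg
      have h1 : 0 ≤ (Λ θ).toReal := EReal.toReal_nonneg (hnn θ)
      have h2 : 0 ≤ d := hd.1
      nlinarith
    have hl := hlim θ hθ
    rw [← coe_toReal_of_mem_effDomain hnn hθ] at hl
    filter_upwards [eventually_measure_le hl hX hθr] with t ht
    refine (measure_mono fun ω hω ↦ ?_).trans ht
    obtain ⟨h1, h2⟩ := hω
    have h3 : d ≤ σ * (X t ω / t) := csInf_le hbdd ⟨h2, by rwa [hσz]⟩
    show θ * (σ * d) ≤ θ * (X t ω / t)
    calc θ * (σ * d) = θ * σ * d := by ring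
      _ ≤ θ * σ * (σ * (X t ω / t)) := by gcongr
      _ = θ * (X t ω / t) := by rw [mul_assoc, hσz]

/-- The Gärtner–Ellis theorem on the line. The limit of the scaled logarithmic moment generating
functions is needed on the effective domain of `Λ` only. -/
theorem satisfiesLDP_legendre [IsProbabilityMeasure P] (hX : ∀ t, 0 < t → AEMeasurable (X t) P)
    (hsm : EssentiallySmooth Λ) (hΛ0 : Λ 0 = 0) (hnn : ∀ θ, 0 ≤ Λ θ)
    (h0 : 0 ∈ interior (effDomain Λ))
    (hmono : ∀ θ, ∀ s ∈ Icc (0 : ℝ) 1, Λ (s * θ) ≤ Λ θ)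
    (hlim : ∀ θ ∈ effDomain Λ, Tendsto (fun t : ℝ≥0 ↦ (((t : ℝ)⁻¹ : ℝ) : EReal) * logMGF P (X t) θ)
      atTop (𝓝 (Λ θ))) :
    SatisfiesLDP P (fun t ω ↦ X t ω / (t : ℝ)) (fun t ↦ (t : ℝ)) (legendre Λ) where
  aemeasurable t ht := (hX t ht).div_const _
  speed := NNReal.tendsto_coe_atTop.2 tendsto_id
  rate := (isGoodRateFunction_legendre hΛ0 hnn h0).toIsRateFunction
  upper C hC := by
    rcases le_or_gt (⨅ x ∈ C, legendre Λ x) 0 with hI | hI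
    · calc _ ≤ (0 : EReal) := by
            refine limsup_le_of_le (by isBoundedDefault) (Eventually.of_forall fun t ↦ ?_)
            refine EReal.mul_nonpos_iff.2 (Or.inl ⟨by positivity, ?_⟩)
            exact ENNReal.log_le_zero_iff.2 prob_le_one
        _ ≤ _ := by rw [EReal.le_neg]; simpa using hI
    · refine EReal.le_of_forall_lt_iff_le.1 fun s hs ↦ ?_
      obtain ⟨r, hr1, hr2⟩ := EReal.exists_between_coe_real
        (max_lt hI (EReal.neg_lt_comm.1 hs) : max 0 (-(s : EReal)) < ⨅ x ∈ C, legendre Λ x)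
      obtain ⟨hr0, hrs⟩ := max_lt_iff.1 hr1
      have hr0 : 0 < r := EReal.coe_lt_coe_iff.1 hr0
      have hrs : -s < r := EReal.coe_lt_coe_iff.1 (by simpa using hrs)
      have hrC : ∀ x ∈ C, (r : EReal) < legendre Λ x := fun x hx ↦
        hr2.trans_le (iInf₂_le x hx)
      have h2 : ∀ᶠ t : ℝ≥0 in atTop, 2 ≤ Real.exp (t * (s + r)) :=
        (Real.tendsto_exp_atTop.comp ((NNReal.tendsto_coe_atTop.2 tendsto_id).atTop_mul_const
          (by linarith : 0 < s + r))).eventually_ge_atTop 2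
      refine limsup_le_of_le (by isBoundedDefault) ?_
      filter_upwards [eventually_measure_closed_le hX hnn hlim hC hr0.le hrC (σ := 1) (by norm_num),
        eventually_measure_closed_le hX hnn hlim hC hr0.le hrC (σ := -1) (by norm_num),
        h2, eventually_gt_atTop 0] with t hp hm h2 ht
      rw [inv_mul_log_le_iff (NNReal.coe_pos.2 ht)]
      have hcover : {ω | X t ω / t ∈ C} ⊆ {ω | X t ω / t ∈ C ∧ 0 ≤ 1 * (X t ω / t)} ∪
          {ω | X t ω / t ∈ C ∧ 0 ≤ -1 * (X t ω / t)} := by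
        intro ω hω
        rcases le_total 0 (X t ω / t) with h | h
        · exact Or.inl ⟨hω, by rwa [one_mul]⟩
        · exact Or.inr ⟨hω, by linarith⟩
      refine (measure_mono hcover).trans ((measure_union_le _ _).trans
        ((add_le_add hp hm).trans ?_))
      rw [← ENNReal.ofReal_add (Real.exp_nonneg _) (Real.exp_nonneg _)]
      refine ENNReal.ofReal_le_ofReal ?_
      have h3 : Real.exp (t * s) = Real.exp (t * (s + r)) * Real.exp (t * -r) := by
        rw [← Real.exp_add]; ring_nf
      nlinarith [Real.exp_pos (t * -r)]
  lower O hO := by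
    have hconv : Convex ℝ (effDomain Λ) := by
      refine OrdConnected.convex ⟨fun x hx y hy z hz ↦ ?_⟩
      -- The effective domain is star-shaped about the origin.
      have hstar : ∀ s ∈ Icc (0 : ℝ) 1, ∀ θ ∈ effDomain Λ, s * θ ∈ effDomain Λ :=
        fun s hs θ hθ ↦ (hmono θ s hs).trans_lt hθ
      rcases lt_trichotomy z 0 with h | rfl | h
      · have hx0 : x < 0 := hz.1.trans_lt h
        have := hstar (z / x) ⟨div_nonneg_of_nonpos h.le hx0.le,
          (div_le_one_of_neg hx0).2 hz.1⟩ x hx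
        rwa [div_mul_cancel₀ _ hx0.ne] at this
      · exact interior_subset h0
      · have hy0 : 0 < y := h.trans_le hz.2
        have := hstar (z / y) ⟨by positivity, (div_le_one hy0).2 hz.2⟩ y hy
        rwa [div_mul_cancel₀ _ hy0.ne'] at this
    rw [EReal.neg_le]
    refine le_iInf₂ fun x hx ↦ EReal.le_of_forall_lt_iff_le.1 fun s hs ↦ ?_
    obtain ⟨M, hM, hMs⟩ := EReal.exists_between_coe_real hs
    have hMs : M < s := EReal.coe_lt_coe_iff.1 hMs
    obtain ⟨η, hη, hηO, hηM⟩ :=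
      exists_deriv_mem_of_legendre_lt_top hsm hΛ0 hnn h0 hconv hmono hO hx hM.le
    rw [EReal.neg_le, ← EReal.coe_neg]
    refine le_liminf_of_le (by isBoundedDefault) ?_
    have hlim' : ∀ᶠ θ in 𝓝 η, Tendsto (fun t : ℝ≥0 ↦ (((t : ℝ)⁻¹ : ℝ) : EReal) * logMGF P (X t) θ)
        atTop (𝓝 ((Λ θ).toReal : EReal)) := by
      filter_upwards [mem_interior_iff_mem_nhds.1 hη] with θ hθ
      rw [coe_toReal_of_mem_effDomain hnn hθ]
      exact hlim θ hθ
    filter_upwards [eventually_le_measure_of_hasDerivAt (c := -s) hlim' hX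
      (hsm.differentiable η hη).2.hasDerivAt hO hηO (by linarith), eventually_gt_atTop 0]
      with t ht ht0
    exact (le_inv_mul_log_iff (NNReal.coe_pos.2 ht0)).2 ht

end GartnerEllis

/-! ### Exponential moments of a Lévy process -/

/-- The least multiple of `1 / (n + 1)` strictly greater than `s`. -/
noncomputable def rightApprox (n : ℕ) (s : ℝ≥0) : ℝ≥0 :=
  (⌊((n : ℝ≥0) + 1) * s⌋₊ + 1 : ℕ) / (n + 1 : ℕ)

lemma tendsto_rightApprox (s : ℝ≥0) : Tendsto (fun n ↦ rightApprox n s) atTop (𝓝[≥] s) := by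
  have hlt : ∀ n : ℕ, s ≤ rightApprox n s := by
    intro n
    rw [rightApprox, le_div_iff₀ (by positivity)]
    push_cast
    rw [mul_comm]
    exact (Nat.lt_floor_add_one _).le
  have hle : ∀ n : ℕ, rightApprox n s ≤ s + 1 / ((n : ℝ≥0) + 1) := by
    intro n
    rw [rightApprox, div_le_iff₀ (by positivity)]
    push_cast
    rw [add_mul s, div_mul_cancel₀ _ (by positivity), mul_comm s]
    gcongr
    exact Nat.floor_le (by positivity)
  refine tendsto_nhdsWithin_iff.2 ⟨?_, Eventually.of_forall hlt⟩
  refine tendsto_of_tendsto_of_tendsto_of_le_of_le tendsto_const_nhds ?_ hlt hle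
  simpa using tendsto_const_nhds.add (tendsto_one_div_add_atTop_nhds_zero_nat (𝕜 := ℝ≥0))

/-- Evaluation of a path at a time, through approximations of the time from the right. It agrees
with plain evaluation on right-continuous paths, and unlike plain evaluation it is jointly
measurable in the path and the time. -/
noncomputable def rightEval (p : (ℝ≥0 → ℝ) × ℝ≥0) : ℝ :=
  limsup (fun n ↦ p.1 (rightApprox n p.2)) atTop

lemma measurable_rightEval : Measurable rightEval := by
  refine Measurable.limsup fun n ↦ ?_
  have h1 : Measurable fun q : (ℝ≥0 → ℝ) × ℕ ↦ q.1 ((q.2 + 1 : ℕ) / (n + 1 : ℕ)) :=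
    measurable_from_prod_countable_left fun k ↦
      measurable_pi_apply (((k + 1 : ℕ) : ℝ≥0) / (n + 1 : ℕ))
  have h2 : Measurable fun p : (ℝ≥0 → ℝ) × ℝ≥0 ↦ (p.1, ⌊((n : ℝ≥0) + 1) * p.2⌋₊) :=
    measurable_fst.prodMk (Nat.measurable_floor.comp (measurable_snd.const_mul _))
  exact h1.comp h2

lemma rightEval_eq {x : ℝ≥0 → ℝ} {s : ℝ≥0} (h : ContinuousWithinAt x (Ici s) s) :
    rightEval (x, s) = x s :=
  (h.tendsto.comp (tendsto_rightApprox s)).limsup_eq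

section Levy

variable {Ω : Type*} [MeasurableSpace Ω] {P : Measure Ω} {S : ℝ≥0 → Ω → ℝ}

namespace IsLevyProcess

lemma ae_rightEval_eq (hS : IsLevyProcess P S) :
    ∀ᵐ ω ∂P, ∀ s, rightEval (fun t ↦ S t ω, s) = S s ω := by
  filter_upwards [hS.cadlag] with ω hω s
  exact rightEval_eq (hω s).1

lemma aemeasurable_comp (hS : IsLevyProcess P S) {T : Ω → ℝ≥0} (hT : Measurable T) :
    AEMeasurable (fun ω ↦ S (T ω) ω) P := by
  refine ⟨fun ω ↦ rightEval (fun t ↦ S t ω, T ω),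
    measurable_rightEval.comp ((measurable_pi_lambda _ hS.measurable).prodMk hT), ?_⟩
  filter_upwards [hS.ae_rightEval_eq] with ω hω
  exact (hω _).symm

/-- An independent random time can be frozen and integrated out last. The joint law is a product on
path space, where evaluation is replaced by the jointly measurable `rightEval`. -/
lemma lintegral_comp [IsProbabilityMeasure P] (hS : IsLevyProcess P S) {T : Ω → ℝ≥0}
    (hT : Measurable T) (hind : IndepFun (fun ω t ↦ S t ω) T P) {G : ℝ → ℝ≥0∞}
    (hG : Measurable G) :
    ∫⁻ ω, G (S (T ω) ω) ∂P = ∫⁻ ω', ∫⁻ ω, G (S (T ω') ω) ∂P ∂P := by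
  have hA : Measurable fun ω t ↦ S t ω := measurable_pi_lambda _ hS.measurable
  have hGr : Measurable fun p ↦ G (rightEval p) := hG.comp measurable_rightEval
  calc
    _ = ∫⁻ ω, G (rightEval (fun t ↦ S t ω, T ω)) ∂P := by
      refine lintegral_congr_ae ?_
      filter_upwards [hS.ae_rightEval_eq] with ω hω
      rw [hω]
    _ = ∫⁻ p, G (rightEval p) ∂(P.map fun ω ↦ (fun t ↦ S t ω, T ω)) :=
      (lintegral_map hGr (hA.prodMk hT)).symm
    _ = ∫⁻ s, ∫⁻ x, G (rightEval (x, s)) ∂(P.map fun ω t ↦ S t ω) ∂(P.map T) := by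
      rw [(indepFun_iff_map_prod_eq_prod_map_map hA.aemeasurable hT.aemeasurable).1 hind]
      have := Measure.isProbabilityMeasure_map (μ := P) hA.aemeasurable
      have := Measure.isProbabilityMeasure_map (μ := P) hT.aemeasurable
      exact lintegral_prod_symm _ hGr.aemeasurable
    _ = ∫⁻ ω', ∫⁻ ω, G (rightEval (fun t ↦ S t ω, T ω')) ∂P ∂P := by
      have := Measure.isProbabilityMeasure_map (μ := P) hA.aemeasurable
      rw [lintegral_map hGr.lintegral_prod_left' hT]
      refine lintegral_congr fun ω' ↦ ?_
      exact lintegral_map (hGr.comp (measurable_id.prodMk measurable_const)) hA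
    _ = _ := by
      refine lintegral_congr fun ω' ↦ lintegral_congr_ae ?_
      filter_upwards [hS.ae_rightEval_eq] with ω hω
      rw [hω]

variable (θ : ℝ)

lemma lintegral_exp_add (hS : IsLevyProcess P S) (s h : ℝ≥0) :
    ∫⁻ ω, ENNReal.ofReal (Real.exp (θ * S (s + h) ω)) ∂P =
      (∫⁻ ω, ENNReal.ofReal (Real.exp (θ * S s ω)) ∂P) *
        ∫⁻ ω, ENNReal.ofReal (Real.exp (θ * S h ω)) ∂P := by
  have hm : Measurable fun x : ℝ ↦ ENNReal.ofReal (Real.exp (θ * x)) := by fun_prop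
  have hind := hS.indep.indepFun_eval_sub (zero_le : (0 : ℝ≥0) ≤ s) (le_self_add (b := h)) hS.zero
  have hstat : ∫⁻ ω, ENNReal.ofReal (Real.exp (θ * S h ω)) ∂P =
      ∫⁻ ω, ENNReal.ofReal (Real.exp (θ * (S (s + h) ω - S s ω))) ∂P :=
    ((hS.stationary s h).comp hm).lintegral_eq.symm
  rw [hstat]
  refine Eq.trans ?_ (lintegral_mul_eq_lintegral_mul_lintegral_of_indepFun''
    (hm.comp (hS.measurable s)).aemeasurable
    (hm.comp ((hS.measurable (s + h)).sub (hS.measurable s))).aemeasurable (hind.comp hm hm))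
  refine lintegral_congr fun ω ↦ ?_
  rw [← ENNReal.ofReal_mul (Real.exp_nonneg _), ← Real.exp_add]
  congr 2
  ring

lemma lintegral_exp_nsmul [IsProbabilityMeasure P] (hS : IsLevyProcess P S) (k : ℕ) (s : ℝ≥0) :
    ∫⁻ ω, ENNReal.ofReal (Real.exp (θ * S (k * s) ω)) ∂P =
      (∫⁻ ω, ENNReal.ofReal (Real.exp (θ * S s ω)) ∂P) ^ k := by
  induction k with
  | zero =>
    rw [pow_zero, ← measure_univ (μ := P), ← lintegral_one]
    refine lintegral_congr_ae ?_
    filter_upwards [hS.zero] with ω hω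
    simp [hω]
  | succ k ih => rw [Nat.cast_succ, add_mul, one_mul, hS.lintegral_exp_add, ih, pow_succ]

variable {θ}

lemma lintegral_exp_div [IsProbabilityMeasure P] (hS : IsLevyProcess P S) {κ : ℝ}
    (hκ : ∫⁻ ω, ENNReal.ofReal (Real.exp (θ * S 1 ω)) ∂P = ENNReal.ofReal (Real.exp κ))
    (k n : ℕ) :
    ∫⁻ ω, ENNReal.ofReal (Real.exp (θ * S (k / (n + 1 : ℕ)) ω)) ∂P =
      ENNReal.ofReal (Real.exp ((k / (n + 1 : ℕ) : ℝ≥0) * κ)) := by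
  have h1 : ∫⁻ ω, ENNReal.ofReal (Real.exp (θ * S (1 / (n + 1 : ℕ)) ω)) ∂P =
      ENNReal.ofReal (Real.exp (κ / (n + 1 : ℕ))) := by
    refine (ENNReal.pow_right_strictMono n.succ_ne_zero).injective ?_
    have := hS.lintegral_exp_nsmul θ (n + 1) (1 / (n + 1 : ℕ))
    rw [mul_one_div_cancel (by positivity), hκ] at this
    simp only [← this]
    rw [← ENNReal.ofReal_pow (Real.exp_nonneg _), ← Real.exp_nat_mul,
      mul_div_cancel₀ _ (by positivity)]
  rw [div_eq_mul_one_div, hS.lintegral_exp_nsmul, h1, ← ENNReal.ofReal_pow (Real.exp_nonneg _),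
    ← Real.exp_nat_mul]
  congr 2
  push_cast
  field_simp

/-- `𝔼[exp (θ S(s))] = exp (s κ(θ))`. Rational times follow from multiplicativity, and Fatou's
lemma along rational times decreasing to `s` gives `≤` at every `s`. Equality then holds because
`≤` also holds at `N - s`, and the two moments multiply to the one at the integer `N ≥ s`. -/
lemma lintegral_exp_eq [IsProbabilityMeasure P] (hS : IsLevyProcess P S) {κ : ℝ}
    (hκ : ∫⁻ ω, ENNReal.ofReal (Real.exp (θ * S 1 ω)) ∂P = ENNReal.ofReal (Real.exp κ))
    (s : ℝ≥0) :
    ∫⁻ ω, ENNReal.ofReal (Real.exp (θ * S s ω)) ∂P = ENNReal.ofReal (Real.exp (s * κ)) := by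
  have hle : ∀ s : ℝ≥0, ∫⁻ ω, ENNReal.ofReal (Real.exp (θ * S s ω)) ∂P
      ≤ ENNReal.ofReal (Real.exp (s * κ)) := by
    intro s
    have hlim : Tendsto (fun n ↦ ENNReal.ofReal (Real.exp (rightApprox n s * κ))) atTop
        (𝓝 (ENNReal.ofReal (Real.exp (s * κ)))) := by
      have hc : Continuous fun u : ℝ≥0 ↦ ENNReal.ofReal (Real.exp (u * κ)) :=
        ENNReal.continuous_ofReal.comp (by fun_prop)
      exact (hc.tendsto s).comp ((tendsto_rightApprox s).mono_right nhdsWithin_le_nhds)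
    calc
      _ = ∫⁻ ω, liminf (fun n ↦ ENNReal.ofReal (Real.exp (θ * S (rightApprox n s) ω))) atTop ∂P := by
        refine lintegral_congr_ae ?_
        filter_upwards [hS.cadlag] with ω hω
        have hc : Continuous fun u : ℝ ↦ ENNReal.ofReal (Real.exp (θ * u)) :=
          ENNReal.continuous_ofReal.comp (by fun_prop)
        exact ((hc.tendsto _).comp ((hω s).1.tendsto.comp (tendsto_rightApprox s))).liminf_eq.symm
      _ ≤ liminf (fun n ↦ ∫⁻ ω, ENNReal.ofReal (Real.exp (θ * S (rightApprox n s) ω)) ∂P) atTop :=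
        lintegral_liminf_le fun n ↦
          ((hS.measurable _).const_mul θ).exp.ennreal_ofReal
      _ = liminf (fun n ↦ ENNReal.ofReal (Real.exp (rightApprox n s * κ))) atTop := by
        simp_rw [rightApprox, hS.lintegral_exp_div hκ]
      _ = _ := hlim.liminf_eq
  refine le_antisymm (hle s) ?_
  obtain ⟨N, hN⟩ := exists_nat_ge s
  have hmul := hS.lintegral_exp_add θ s (N - s)
  have hNeq := hS.lintegral_exp_nsmul θ N 1
  rw [mul_one, hκ, ← ENNReal.ofReal_pow (Real.exp_nonneg _), ← Real.exp_nat_mul] at hNeq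
  rw [add_tsub_cancel_of_le hN, hNeq] at hmul
  have hpos : 0 < Real.exp ((N - s : ℝ≥0) * κ) := Real.exp_pos _
  have h1 : ENNReal.ofReal (Real.exp (s * κ)) * ENNReal.ofReal (Real.exp ((N - s : ℝ≥0) * κ)) ≤
      (∫⁻ ω, ENNReal.ofReal (Real.exp (θ * S s ω)) ∂P) *
        ENNReal.ofReal (Real.exp ((N - s : ℝ≥0) * κ)) := by
    calc _ = ENNReal.ofReal (Real.exp (N * κ)) := by
          rw [← ENNReal.ofReal_mul (Real.exp_nonneg _), ← Real.exp_add, NNReal.coe_sub hN]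
          congr 2
          push_cast
          ring
      _ ≤ _ := hmul.trans_le (by gcongr; exact hle _)
  exact (ENNReal.mul_le_mul_iff_left (ENNReal.ofReal_pos.2 hpos).ne' ENNReal.ofReal_ne_top).1 h1

end IsLevyProcess

lemma lintegral_exp_eq_of_kappa_eq {θ κ : ℝ} (h : kappa P S θ = (κ : EReal)) :
    ∫⁻ ω, ENNReal.ofReal (Real.exp (θ * S 1 ω)) ∂P = ENNReal.ofReal (Real.exp κ) := by
  rw [← EReal.exp_coe, ← h, kappa, logMGF, ENNReal.exp_log]

/-- Where `κ_S` is finite, the time-changed process inherits its logarithmic moment generating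
function from the time change. -/
lemma logMGF_timeChange [IsProbabilityMeasure P] (hS : IsLevyProcess P S) {T : Ω → ℝ≥0}
    (hT : Measurable T) (hind : IndepFun (fun ω t ↦ S t ω) T P) {θ κ : ℝ}
    (hκ : kappa P S θ = (κ : EReal)) :
    logMGF P (fun ω ↦ S (T ω) ω) θ = logMGF P (fun ω ↦ (T ω : ℝ)) κ := by
  unfold logMGF
  rw [hS.lintegral_comp hT hind (G := fun x ↦ ENNReal.ofReal (Real.exp (θ * x))) (by fun_prop)]
  simp_rw [hS.lintegral_exp_eq (lintegral_exp_eq_of_kappa_eq hκ), mul_comm κ]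

lemma kappa_zero [IsProbabilityMeasure P] : kappa P S 0 = 0 := by
  simp [kappa, logMGF]

lemma kappa_ne_bot [IsProbabilityMeasure P] (hS : Measurable (S 1)) (θ : ℝ) :
    kappa P S θ ≠ ⊥ := by
  rw [kappa, logMGF, Ne, ENNReal.log_eq_bot_iff, lintegral_eq_zero_iff (by fun_prop)]
  intro h
  obtain ⟨ω, hω⟩ := h.exists
  exact (ENNReal.ofReal_pos.2 (Real.exp_pos _)).ne' hω

/-- Contracting `θ` towards the origin does not increase the positive part of `κ_S`, since
`exp (s a) ≤ s exp a + (1 - s)` by convexity. -/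
lemma kappa_mul_le [IsProbabilityMeasure P] (hS : Measurable (S 1)) (θ : ℝ) {s : ℝ}
    (hs : s ∈ Icc (0 : ℝ) 1) : kappa P S (s * θ) ≤ max (kappa P S θ) 0 := by
  rw [kappa, kappa, logMGF, logMGF, ← ENNReal.log_one, ← ENNReal.log_monotone.map_max]
  refine ENNReal.log_le_log ?_
  set m := ∫⁻ ω, ENNReal.ofReal (Real.exp (θ * S 1 ω)) ∂P
  calc
    _ ≤ ∫⁻ ω, (ENNReal.ofReal s * ENNReal.ofReal (Real.exp (θ * S 1 ω)) +
        ENNReal.ofReal (1 - s)) ∂P := by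
      refine lintegral_mono fun ω ↦ ?_
      rw [← ENNReal.ofReal_mul hs.1, ← ENNReal.ofReal_add
        (mul_nonneg hs.1 (Real.exp_nonneg _)) (sub_nonneg.2 hs.2)]
      refine ENNReal.ofReal_le_ofReal ?_
      have := convexOn_exp.2 (mem_univ (θ * S 1 ω)) (mem_univ 0) hs.1 (sub_nonneg.2 hs.2)
        (by ring)
      simpa [mul_assoc] using this
    _ = ENNReal.ofReal s * m + ENNReal.ofReal (1 - s) := by
      rw [lintegral_add_right _ measurable_const, lintegral_const_mul _ (by fun_prop)]
      simp [m]
    _ ≤ ENNReal.ofReal s * max m 1 + ENNReal.ofReal (1 - s) * max m 1 := by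
      gcongr
      · exact le_max_left _ _
      · exact le_mul_of_one_le_right' (le_max_right _ _)
    _ = max m 1 := by
      rw [← add_mul, ← ENNReal.ofReal_add hs.1 (sub_nonneg.2 hs.2)]
      simp

end Levy

/-! ### The function `Υ_f` -/

section Upsilon

variable {f : ℝ → ℝ}

lemma Upsilon_of_nonpos (hf0 : f 0 = 0) {ρ : EReal} (h : ρ ≤ 0) : Upsilon f ρ = 0 := by
  have htop : ρ ≠ ⊤ := fun h' ↦ by simp [h'] at h
  by_cases h0 : 0 ≤ ρ
  · have : ρ = 0 := le_antisymm h h0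
    simp [Upsilon, this, hf0]
  · simp [Upsilon, htop, h0]

lemma Upsilon_mono (hf : MonotoneOn f (Ici 0)) (hf0 : f 0 = 0) : Monotone (Upsilon f) := by
  intro a b hab
  by_cases hb : b = ⊤
  · simp [Upsilon, hb]
  have ha : a ≠ ⊤ := ne_top_of_le_ne_top hb hab
  by_cases hb0 : 0 ≤ b
  · have hb1 : 0 ≤ b.toReal := EReal.toReal_nonneg hb0
    by_cases ha0 : 0 ≤ a
    · simp only [Upsilon, ha, hb, ha0, hb0, if_true, if_false, EReal.coe_le_coe_iff]
      exact hf (EReal.toReal_nonneg ha0) hb1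
        (EReal.toReal_le_toReal hab (ne_bot_of_le_ne_bot (by simp) ha0) hb)
    · simp only [Upsilon, ha, hb, ha0, hb0, if_true, if_false]
      rw [← EReal.coe_zero, EReal.coe_le_coe_iff, ← hf0]
      exact hf self_mem_Ici hb1 hb1
  · rw [Upsilon_of_nonpos hf0 (not_le.1 hb0).le, Upsilon_of_nonpos hf0 (hab.trans (not_le.1 hb0).le)]

lemma Upsilon_nonneg (hf : MonotoneOn f (Ici 0)) (hf0 : f 0 = 0) (ρ : EReal) :
    0 ≤ Upsilon f ρ :=
  (Upsilon_of_nonpos hf0 bot_le).ge.trans (Upsilon_mono hf hf0 bot_le)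

lemma Upsilon_lt_top_iff {ρ : EReal} : Upsilon f ρ < ⊤ ↔ ρ ≠ ⊤ := by
  unfold Upsilon
  split_ifs <;> simp_all [EReal.coe_lt_top]

end Upsilon

/-! ### The time-changed Lévy process -/

theorem mainTheorem10 {Ω : Type*} [MeasurableSpace Ω] (P : Measure Ω) [IsProbabilityMeasure P]
    (S : ℝ≥0 → Ω → ℝ) (hS : IsLightTailedLevy P S)
    (f : ℝ → ℝ) (L : ℝ≥0 → Ω → ℝ≥0) (hL : IsTimeChange P f L)
    (hindep : IndepFun (fun ω t ↦ S t ω) (fun ω t ↦ L t ω) P)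
    (hsmooth : EssentiallySmooth (LambdaFS P f S)) :
    SatisfiesLDP P (fun t ω ↦ S (L t ω) ω / (t : ℝ)) (fun t ↦ (t : ℝ))
        (legendre (LambdaFS P f S)) ∧
      IsGoodRateFunction (legendre (LambdaFS P f S)) := by
  have hlevy := hS.toIsLevyProcess
  have hΛ0 : LambdaFS P f S 0 = 0 := by
    rw [LambdaFS, kappa_zero, Upsilon_of_nonpos hL.zero le_rfl]
  have hnn : ∀ θ, 0 ≤ LambdaFS P f S θ := fun θ ↦ Upsilon_nonneg hL.mono hL.zero _
  have h0 : 0 ∈ interior (effDomain (LambdaFS P f S)) := by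
    rw [mem_interior_iff_mem_nhds]
    filter_upwards [hS.finite_near_zero] with θ hθ
    exact Upsilon_lt_top_iff.2 hθ.1
  refine ⟨satisfiesLDP_legendre (X := fun t ω ↦ S (L t ω) ω)
    (fun t _ ↦ hlevy.aemeasurable_comp (hL.measurable t)) hsmooth hΛ0 hnn h0 ?_ ?_,
    isGoodRateFunction_legendre hΛ0 hnn h0⟩
  · intro θ s hs
    refine (Upsilon_mono hL.mono hL.zero (kappa_mul_le (hlevy.measurable 1) θ hs)).trans ?_
    rcases le_total (kappa P S θ) 0 with h | h
    · rw [max_eq_right h, Upsilon_of_nonpos hL.zero le_rfl]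
      exact hnn θ
    · rw [max_eq_left h, LambdaFS]
  · intro θ hθ
    obtain ⟨κ, hκ⟩ : ∃ κ : ℝ, kappa P S θ = (κ : EReal) :=
      ⟨_, (EReal.coe_toReal (Upsilon_lt_top_iff.1 hθ)
        (kappa_ne_bot (hlevy.measurable 1) θ)).symm⟩
    have hlim := hL.tendsto κ
    rw [← hκ] at hlim
    refine hlim.congr fun t ↦ ?_
    rw [logMGF_timeChange hlevy (hL.measurable t)
      (hindep.comp measurable_id (measurable_pi_apply t)) hκ]
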